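/- Let $a>0$ and $\mathcal K(x)=\dfrac{1-e^{-|x|/a}}{|x|}$ for $x\in\mathbb R^3\setminus\{0\}$. For Lebesgue measurable $f,g:\mathbb R^3\to\mathbb R$ put $$V(f,g)=\int_{\mathbb R^3}\int_{\mathbb R^3}\mathcal K(x-y)\,f(x)\,g(y)\,dx\,dy,$$ where $V(|f|,|g|)\in[0,+\infty]$ is always defined, and let $\mathcal E_1$ be the set of Lebesgue measurable $f:\mathbb R^3\to\mathbb R$ with $V(|f|,|f|)<+\infty$, functions that agree almost everywhere being identified. Then: 1. If $f\in\mathcal E_1$ is not almost everywhere zero, then $V(f,f)>0$. 2. For all $f,g\in\mathcal E_1$ the integral defining $V(f,g)$ converges absolutely, that is, $(x,y)\mapsto\mathcal K(x-y)f(x)g(y)$ is integrable on $\mathbb R^3\times\mathbb R^3$, and $|V(f,g)|^2\le V(f,f)\,V(g,g)$. 3. $\mathcal E_1$ is a real vector space and $V$ is an inner product on it. -/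

import Mathlib

open MeasureTheory

noncomputable section

namespace BoppPodolsky

/-- Three-dimensional Euclidean space. -/
abbrev R3 : Type := EuclideanSpace ℝ (Fin 3)

/-- The Bopp-Podolsky potential `(1 - exp (-|x| / a)) / |x|`
(its value at the single point `0` plays no role in the integrals below). -/
def kernel (a : ℝ) (x : R3) : ℝ := (1 - Real.exp (-‖x‖ / a)) / ‖x‖

/-- The Bopp-Podolsky energy of a pair of nonnegative functions, as an element of `[0, ∞]`. -/
def lenergy (a : ℝ) (f g : R3 → ℝ) : ENNReal :=
  ∫⁻ y : R3, ∫⁻ x : R3, ENNReal.ofReal (kernel a (x - y) * f x * g y)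

/-- The Bopp-Podolsky energy `V (f, g)` of a pair of real functions. -/
def energy (a : ℝ) (f g : R3 → ℝ) : ℝ :=
  ∫ y : R3, ∫ x : R3, kernel a (x - y) * f x * g y

/-- The (Lebesgue) measurable functions with `V (|f|, |f|) < ∞`. -/
def E1 (a : ℝ) : Set (R3 → ℝ) :=
  {f | AEMeasurable f volume ∧ lenergy a (fun x => |f x|) (fun x => |f x|) < ⊤}

end BoppPodolsky

end

/-! The potential is a superposition of Gaussians with positive weights: `(1 - exp (-r / a)) / r` is
the integral over `u > 0` of `gaussWeight a u * exp (-r² u²)`. Each Gaussian in `x - y` is in turn,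
up to a constant, the integral over centres `z` of a product of one Gaussian in `x - z` and one in
`y - z`. Hence `K (x - y) = ∫ φ_θ(x) φ_θ(y) dθ` with `θ = (u, z)` and `φ_θ ≥ 0`
(`isMixture_kernel`), and `V (f, g)` becomes the `L²` product of the transforms `θ ↦ ∫ φ_θ f` and `θ
↦ ∫ φ_θ g` (`IsMixture.integral_kernel_mul`). Nonnegativity of `φ` lets Tonelli reduce absolute
convergence to the same formula for `|f|`, `|g|`; positivity and Cauchy-Schwarz are then those of
`L²`.

For definiteness, `V (f, f) = 0` makes the Gaussian convolutions of `f` vanish for almost every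
width and centre. For a suitable width, continuity extends this to every centre. Completing the
square, the Laplace transform of `f` times a Gaussian vanishes, and uniqueness of that transform
gives `f = 0`. -/

namespace BoppPodolsky

/-! ### The potential as a mixture of Gaussians -/

/-- The Cauchy-Schlömilch integral. -/
theorem integral_exp_neg_sq_sub_inv_sq {r b : ℝ} (hr : 0 < r) (hb : 0 < b) :
    ∫ u in Set.Ioi (0 : ℝ), Real.exp (-(r ^ 2 * u ^ 2) - b ^ 2 / u ^ 2)
      = √Real.pi / (2 * r) * Real.exp (-(2 * r * b)) := by
  have hpos : ∀ v : ℝ, 0 < v ^ 2 + 4 * r * b := fun v => by positivity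
  have habs : ∀ v : ℝ, |v| < √(v ^ 2 + 4 * r * b) := fun v =>
    Real.lt_sqrt_of_sq_lt (by rw [sq_abs]; nlinarith [mul_pos hr hb])
  -- `F v` is the positive root of `r u² - v u - b = 0`, so `F` inverts `u ↦ r u - b / u`; this
  -- substitution turns the exponent into `-v² - 2 r b`.
  set F : ℝ → ℝ := fun v => (v + √(v ^ 2 + 4 * r * b)) / (2 * r) with hF
  set F' : ℝ → ℝ := fun v => (1 + v / √(v ^ 2 + 4 * r * b)) / (2 * r) with hF'
  have hFpos : ∀ v, 0 < F v := fun v =>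
    div_pos (by linarith [habs v, neg_abs_le v]) (by positivity)
  have hFeq : ∀ v, r * F v - b / F v = v := by
    intro v
    have h2 := Real.sq_sqrt (hpos v).le
    have h0 := (hFpos v).ne'
    have : r * F v * F v - b = v * F v := by
      simp only [hF]
      generalize √(v ^ 2 + 4 * r * b) = q at h2 ⊢
      field_simp
      linear_combination h2
    field_simp
    linarith
  have hderiv : ∀ v ∈ (Set.univ : Set ℝ), HasDerivWithinAt F (F' v) Set.univ v := by
    intro v _
    have h1 : HasDerivAt (fun v : ℝ => v ^ 2 + 4 * r * b) (2 * v) v := by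
      simpa using (hasDerivAt_pow 2 v).add_const (4 * r * b)
    have h2 := ((hasDerivAt_id v).add (h1.sqrt (hpos v).ne')).div_const (2 * r)
    refine HasDerivAt.hasDerivWithinAt (h2.congr_deriv ?_)
    simp only [hF']
    congr 2
    have := (Real.sqrt_pos.2 (hpos v)).ne'
    field_simp
  have hinj : Set.InjOn F Set.univ := by
    intro v _ w _ h
    rw [← hFeq v, ← hFeq w, h]
  have himg : F '' Set.univ = Set.Ioi 0 := by
    ext u
    constructor
    · rintro ⟨v, -, rfl⟩
      exact hFpos v
    · intro (hu : 0 < u)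
      refine ⟨r * u - b / u, trivial, ?_⟩
      have : (r * u - b / u) ^ 2 + 4 * r * b = (r * u + b / u) ^ 2 := by
        field_simp
        ring
      simp only [hF]
      rw [this, Real.sqrt_sq (by positivity)]
      field_simp
      ring
  have hF'pos : ∀ v, 0 ≤ F' v := by
    intro v
    have h3 : -1 ≤ v / √(v ^ 2 + 4 * r * b) := by
      rw [le_div_iff₀ (Real.sqrt_pos.2 (hpos v))]
      linarith [habs v, neg_abs_le v]
    exact div_nonneg (by linarith) (by positivity)
  rw [← himg, integral_image_eq_integral_abs_deriv_smul MeasurableSet.univ hderiv hinj]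
  -- Up to the factor `1 / (2 r)`, the Jacobian is `1` plus an odd function, which contributes
  -- nothing against the even Gaussian.
  have hodd : ∫ v : ℝ, v / √(v ^ 2 + 4 * r * b) * Real.exp (-v ^ 2) = 0 := by
    have h := integral_neg_eq_self (fun v : ℝ => v / √(v ^ 2 + 4 * r * b) * Real.exp (-v ^ 2)) volume
    simp only [neg_sq, neg_div, neg_mul, integral_neg] at h
    linarith
  have hgauss : Integrable (fun v : ℝ => Real.exp (-v ^ 2)) := by
    simpa using integrable_exp_neg_mul_sq one_pos
  have hint : Integrable (fun v : ℝ => v / √(v ^ 2 + 4 * r * b) * Real.exp (-v ^ 2)) := by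
    refine hgauss.bdd_mul (c := 1) (Measurable.aestronglyMeasurable (by fun_prop)) (.of_forall fun v => ?_)
    rw [Real.norm_eq_abs, abs_div, abs_of_nonneg (Real.sqrt_nonneg _)]
    exact div_le_one_of_le₀ (habs v).le (Real.sqrt_nonneg _)
  have hval : ∫ v : ℝ, Real.exp (-v ^ 2) = √Real.pi := by
    simpa using integral_gaussian 1
  calc ∫ v in Set.univ, |F' v| • Real.exp (-(r ^ 2 * F v ^ 2) - b ^ 2 / F v ^ 2)
      = ∫ v, Real.exp (-(2 * r * b)) / (2 * r) *
          (Real.exp (-v ^ 2) + v / √(v ^ 2 + 4 * r * b) * Real.exp (-v ^ 2)) := by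
        rw [setIntegral_univ]
        refine integral_congr_ae (.of_forall fun v => ?_)
        have h0 := (hFpos v).ne'
        have h4 : -(r ^ 2 * F v ^ 2) - b ^ 2 / F v ^ 2 = -(2 * r * b) + -v ^ 2 := by
          conv_rhs => rw [← hFeq v]
          field_simp
          ring
        beta_reduce
        rw [abs_of_nonneg (hF'pos v), h4, Real.exp_add, smul_eq_mul]
        simp only [hF']
        ring
    _ = √Real.pi / (2 * r) * Real.exp (-(2 * r * b)) := by
        rw [integral_const_mul, integral_add hgauss hint, hodd, hval]
        ring

/-- The weight of the Gaussian `exp (-u² r²)` in the Bopp-Podolsky potential. -/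
noncomputable def gaussWeight (a u : ℝ) : ℝ := 2 / √Real.pi * (1 - Real.exp (-((1 / (2 * a)) ^ 2 / u ^ 2)))

theorem gaussWeight_pos {a u : ℝ} (ha : 0 < a) (hu : 0 < u) : 0 < gaussWeight a u := by
  have : Real.exp (-((1 / (2 * a)) ^ 2 / u ^ 2)) < 1 :=
    Real.exp_lt_one_iff.2 (neg_neg_of_pos (by positivity))
  have h2 : 0 < √Real.pi := Real.sqrt_pos.2 Real.pi_pos
  exact mul_pos (by positivity) (by linarith)

@[fun_prop]
theorem measurable_gaussWeight (a : ℝ) : Measurable (gaussWeight a) := by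
  unfold gaussWeight
  fun_prop

theorem integrableOn_and_integral_gaussWeight {a r : ℝ} (ha : 0 < a) (hr : 0 < r) :
    IntegrableOn (fun u => gaussWeight a u * Real.exp (-(r ^ 2 * u ^ 2))) (Set.Ioi 0) ∧
    ∫ u in Set.Ioi 0, gaussWeight a u * Real.exp (-(r ^ 2 * u ^ 2))
      = (1 - Real.exp (-r / a)) / r := by
  -- This `b` makes `2 r b = r / a` in the Cauchy-Schlömilch integral.
  set b := 1 / (2 * a) with hb
  have hb0 : 0 < b := by positivity
  have h1 : IntegrableOn (fun u => Real.exp (-(r ^ 2 * u ^ 2))) (Set.Ioi 0) := by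
    simpa only [neg_mul] using (integrable_exp_neg_mul_sq (b := r ^ 2) (by positivity)).integrableOn
  have h2 : IntegrableOn (fun u => Real.exp (-(r ^ 2 * u ^ 2) - b ^ 2 / u ^ 2)) (Set.Ioi 0) := by
    refine h1.mono' (by fun_prop) (.of_forall fun u => ?_)
    rw [Real.norm_eq_abs, Real.abs_exp]
    exact Real.exp_le_exp.2 (by have : 0 ≤ b ^ 2 / u ^ 2 := by positivity
                                linarith)
  have heq : (fun u => gaussWeight a u * Real.exp (-(r ^ 2 * u ^ 2))) = fun u =>
      2 / √Real.pi * (Real.exp (-(r ^ 2 * u ^ 2)) - Real.exp (-(r ^ 2 * u ^ 2) - b ^ 2 / u ^ 2)) := by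
    funext u
    rw [sub_eq_add_neg _ (b ^ 2 / u ^ 2), Real.exp_add, gaussWeight]
    ring
  rw [heq]
  refine ⟨(h1.sub h2).const_mul _, ?_⟩
  have h3 : ∫ u in Set.Ioi 0, Real.exp (-(r ^ 2 * u ^ 2)) = √Real.pi / (2 * r) := by
    have := integral_gaussian_Ioi (r ^ 2)
    simp only [neg_mul] at this
    rw [this, Real.sqrt_div Real.pi_pos.le, Real.sqrt_sq hr.le]
    field_simp
  rw [integral_const_mul, integral_sub h1 h2, h3, integral_exp_neg_sq_sub_inv_sq hr hb0]
  have h4 : -(2 * r * b) = -r / a := by rw [hb]; field_simp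
  have h5 : √Real.pi ≠ 0 := (Real.sqrt_pos.2 Real.pi_pos).ne'
  rw [h4]
  field_simp

/-! ### Uniqueness for Laplace transforms and Gaussian convolutions -/

/-- Finite measures with the same finite Laplace transform are equal. -/
theorem ext_of_integral_exp_inner_eq {E : Type*} [NormedAddCommGroup E] [InnerProductSpace ℝ E]
    [MeasurableSpace E] [BorelSpace E] [SecondCountableTopology E] [CompleteSpace E]
    {μ ν : Measure E} [IsFiniteMeasure μ] [IsFiniteMeasure ν]
    (hμ : ∀ t : E, Integrable (fun x => Real.exp (inner ℝ x t)) μ)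
    (h : ∀ t : E, ∫ x, Real.exp (inner ℝ x t) ∂μ = ∫ x, Real.exp (inner ℝ x t) ∂ν) : μ = ν := by
  have hzero : μ = 0 ↔ ν = 0 := by
    have h0 := h 0
    simp only [inner_zero_right, Real.exp_zero, integral_const, smul_eq_mul, mul_one] at h0
    simpa [measureReal_def, ENNReal.toReal_eq_zero_iff] using
      (show μ.real Set.univ = 0 ↔ ν.real Set.univ = 0 by rw [h0])
  refine Measure.ext_of_charFun (funext fun t => ?_)
  have hmgf : ProbabilityTheory.mgf (fun x => inner ℝ x t) μ
      = ProbabilityTheory.mgf (fun x => inner ℝ x t) ν := by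
    funext s
    simpa only [ProbabilityTheory.mgf, inner_smul_right] using h (s • t)
  have huniv : ProbabilityTheory.integrableExpSet (fun x => inner ℝ x t) μ = Set.univ := by
    refine Set.eq_univ_of_forall fun s => ?_
    simpa only [ProbabilityTheory.integrableExpSet, inner_smul_right, Set.mem_ofPred_eq] using hμ (s • t)
  -- Equality of the real moment generating functions continues analytically to the whole plane; the
  -- value at `I` is the characteristic function.
  have := ProbabilityTheory.eqOn_complexMGF_of_mgf' hmgf hzero (x := Complex.I) (by simp [huniv])
  simpa only [ProbabilityTheory.complexMGF, charFun_apply, mul_comm Complex.I] using this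

/-- A function whose Laplace transform converges and vanishes everywhere is zero. -/
theorem ae_eq_zero_of_integral_mul_exp_inner_eq_zero {E : Type*} [NormedAddCommGroup E]
    [InnerProductSpace ℝ E] [MeasurableSpace E] [BorelSpace E] [SecondCountableTopology E]
    [CompleteSpace E] {μ : Measure E} {G : E → ℝ}
    (hG : ∀ t : E, Integrable (fun x => G x * Real.exp (inner ℝ x t)) μ)
    (h : ∀ t : E, ∫ x, G x * Real.exp (inner ℝ x t) ∂μ = 0) : G =ᵐ[μ] 0 := by
  have hG0 : Integrable G μ := by simpa using hG 0
  have hfin : ∀ {H : E → ℝ}, Integrable H μ →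
      IsFiniteMeasure (μ.withDensity fun x => ENNReal.ofReal (H x)) := fun hH =>
    isFiniteMeasure_withDensity_ofReal hH.2
  have := hfin hG0
  have := hfin hG0.neg
  have hpart : ∀ {H : E → ℝ}, (∀ t : E, Integrable (fun x => H x * Real.exp (inner ℝ x t)) μ) →
      ∀ t, Integrable (fun x => max (H x) 0 * Real.exp (inner ℝ x t)) μ := by
    intro H hH t
    refine (hH t).pos_part.congr (.of_forall fun x => ?_)
    beta_reduce
    rw [max_mul_of_nonneg _ _ (Real.exp_nonneg _), zero_mul]
  have hneg : ∀ t : E, Integrable (fun x => -G x * Real.exp (inner ℝ x t)) μ := fun t =>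
    (hG t).neg.congr (.of_forall fun x => by simp)
  have hint : ∀ {H : E → ℝ}, Integrable H μ → ∀ t : E,
      ∫ x, Real.exp (inner ℝ x t) ∂(μ.withDensity fun x => ENNReal.ofReal (H x))
        = ∫ x, max (H x) 0 * Real.exp (inner ℝ x t) ∂μ := by
    intro H hH t
    rw [integral_withDensity_eq_integral_toReal_smul₀ hH.1.aemeasurable.ennreal_ofReal
      (.of_forall fun x => ENNReal.ofReal_lt_top)]
    simp only [ENNReal.toReal_ofReal', smul_eq_mul]
  -- The positive and negative parts of `G` are densities of two finite measures with equal Laplace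
  -- transforms.
  have heq : μ.withDensity (fun x => ENNReal.ofReal (G x))
      = μ.withDensity (fun x => ENNReal.ofReal ((-G) x)) := by
    refine ext_of_integral_exp_inner_eq (fun t => ?_) (fun t => ?_)
    · rw [integrable_withDensity_iff_integrable_smul₀' hG0.1.aemeasurable.ennreal_ofReal
        (.of_forall fun x => ENNReal.ofReal_lt_top)]
      simpa only [ENNReal.toReal_ofReal', smul_eq_mul] using hpart hG t
    · rw [hint hG0, hint hG0.neg]
      simp only [Pi.neg_apply]
      rw [← sub_eq_zero, ← integral_sub (hpart hG t) (hpart hneg t)]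
      refine (integral_congr_ae (.of_forall fun x => ?_)).trans (h t)
      simp only [← sub_mul, max_zero_sub_eq_self]
  rw [withDensity_eq_iff hG0.1.aemeasurable.ennreal_ofReal hG0.neg.1.aemeasurable.ennreal_ofReal
    hG0.lintegral_lt_top.ne] at heq
  filter_upwards [heq] with x hx
  rcases le_total 0 (G x) with h0 | h0
  · rw [Pi.neg_apply, ENNReal.ofReal_of_nonpos (neg_nonpos.2 h0), ENNReal.ofReal_eq_zero] at hx
    exact le_antisymm hx h0
  · rw [Pi.neg_apply, ENNReal.ofReal_of_nonpos h0, eq_comm, ENNReal.ofReal_eq_zero] at hx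
    exact le_antisymm h0 (by simpa using hx)

/-- A function whose convolutions with one Gaussian converge absolutely and vanish is zero. -/
theorem ae_eq_zero_of_integral_mul_gaussian_eq_zero {E : Type*} [NormedAddCommGroup E]
    [InnerProductSpace ℝ E] [MeasurableSpace E] [BorelSpace E] [SecondCountableTopology E]
    [CompleteSpace E] {μ : Measure E} {f : E → ℝ} {s : ℝ} (hs : s ≠ 0)
    (hf : ∀ z : E, Integrable (fun x => f x * Real.exp (-(s * ‖x - z‖ ^ 2))) μ)
    (h : ∀ z : E, ∫ x, f x * Real.exp (-(s * ‖x - z‖ ^ 2)) ∂μ = 0) : f =ᵐ[μ] 0 := by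
  -- Completing the square: the centre `t / (2 s)` produces the linear term `⟨x, t⟩`.
  have key : ∀ t x : E, f x * Real.exp (-(s * ‖x‖ ^ 2)) * Real.exp (inner ℝ x t)
      = Real.exp (s * ‖(1 / (2 * s)) • t‖ ^ 2) *
        (f x * Real.exp (-(s * ‖x - (1 / (2 * s)) • t‖ ^ 2))) := by
    intro t x
    rw [mul_left_comm, mul_assoc, ← Real.exp_add, ← Real.exp_add, norm_sub_sq_real,
      inner_smul_right]
    congr 2
    field_simp
    ring
  have := ae_eq_zero_of_integral_mul_exp_inner_eq_zero (μ := μ)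
    (G := fun x => f x * Real.exp (-(s * ‖x‖ ^ 2)))
    (fun t => by simpa only [key] using (hf _).const_mul _)
    (fun t => by simp only [key, integral_const_mul, h, mul_zero])
  filter_upwards [this] with x hx
  simpa [Real.exp_ne_zero] using hx

/-- If `f` is absolutely integrable against one Gaussian, its convolutions with narrower Gaussians
converge absolutely. -/
theorem integrable_mul_gaussian_of_integrable {E : Type*} [NormedAddCommGroup E]
    [MeasurableSpace E] [BorelSpace E] {μ : Measure E} {f : E → ℝ} {s : ℝ} (hs : 0 ≤ s) {z₀ : E}
    (hf : Integrable (fun x => f x * Real.exp (-(s * ‖x - z₀‖ ^ 2))) μ)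
    (hfm : AEStronglyMeasurable f μ) :
    (∀ z, Integrable (fun x => f x * Real.exp (-(2 * s * ‖x - z‖ ^ 2))) μ) ∧
    Continuous fun z => ∫ x, f x * Real.exp (-(2 * s * ‖x - z‖ ^ 2)) ∂μ := by
  have hmeas : ∀ z, AEStronglyMeasurable (fun x => f x * Real.exp (-(2 * s * ‖x - z‖ ^ 2))) μ :=
    fun z => hfm.mul (Continuous.aestronglyMeasurable (by fun_prop))
  -- From `‖x - z₀‖² ≤ 2 ‖x - z‖² + 2 R²`: doubling the exponent pays for moving the centre,
  -- uniformly over bounded shifts, as dominated convergence requires.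
  have hbound : ∀ (R : ℝ) (z x : E), ‖z - z₀‖ ≤ R → ‖f x * Real.exp (-(2 * s * ‖x - z‖ ^ 2))‖
      ≤ Real.exp (2 * s * R ^ 2) * ‖f x * Real.exp (-(s * ‖x - z₀‖ ^ 2))‖ := by
    intro R z x hR
    rw [norm_mul, norm_mul, mul_left_comm, Real.norm_eq_abs (Real.exp _), Real.norm_eq_abs
      (Real.exp _), Real.abs_exp, Real.abs_exp, ← Real.exp_add]
    gcongr
    have h1 : ‖x - z₀‖ ≤ ‖x - z‖ + R := (norm_sub_le_norm_sub_add_norm_sub x z z₀).trans (by gcongr)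
    have h2 : ‖x - z₀‖ ^ 2 ≤ (‖x - z‖ + R) ^ 2 := by gcongr
    have h3 : ‖x - z₀‖ ^ 2 ≤ 2 * ‖x - z‖ ^ 2 + 2 * R ^ 2 := by
      nlinarith [sq_nonneg (‖x - z‖ - R)]
    nlinarith [mul_le_mul_of_nonneg_left h3 hs]
  refine ⟨fun z => (hf.norm.const_mul _).mono' (hmeas z) (.of_forall fun x => hbound _ z x le_rfl),
    continuous_iff_continuousAt.2 fun z => ?_⟩
  refine continuousAt_of_dominated (.of_forall hmeas) (bound := fun x =>
      Real.exp (2 * s * (‖z - z₀‖ + 1) ^ 2) * ‖f x * Real.exp (-(s * ‖x - z₀‖ ^ 2))‖)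
    ?_ (hf.norm.const_mul _) (.of_forall fun x => by fun_prop)
  filter_upwards [Metric.ball_mem_nhds z one_pos] with w hw
  refine .of_forall fun x => hbound _ w x ?_
  rw [Metric.mem_ball, dist_eq_norm] at hw
  linarith [norm_sub_le_norm_sub_add_norm_sub w z z₀]

/-! ### Energies of mixture kernels -/

/-- The kernel `k` on `X` is a superposition over `(Θ, M)` of the rank one kernels
`φ θ x * φ θ y`, with `φ` nonnegative. -/
structure IsMixture {X Θ : Type*} [MeasurableSpace X] [MeasurableSpace Θ] (ν : Measure X)
    (M : Measure Θ) (k : X × X → ℝ) (φ : Θ → X → ℝ) : Prop where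
  measurable_kernel : Measurable k
  kernel_nonneg : ∀ p, 0 ≤ k p
  measurable_feature : Measurable (Function.uncurry φ)
  feature_nonneg : ∀ θ x, 0 ≤ φ θ x
  lintegral_eq : ∀ᵐ p ∂(ν.prod ν),
    ∫⁻ θ, ENNReal.ofReal (φ θ p.1 * φ θ p.2) ∂M = ENNReal.ofReal (k p)

namespace IsMixture

variable {X Θ : Type*} [MeasurableSpace X] [MeasurableSpace Θ] {ν : Measure X}
  {M : Measure Θ} {k : X × X → ℝ} {φ : Θ → X → ℝ} {f g : X → ℝ}

theorem aestronglyMeasurable_kernel_mul (h : IsMixture ν M k φ) (hf : AEMeasurable f ν)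
    (hg : AEMeasurable g ν) :
    AEStronglyMeasurable (fun p : X × X => k p * f p.1 * g p.2) (ν.prod ν) :=
  ((h.measurable_kernel.aemeasurable.mul hf.comp_fst).mul hg.comp_snd).aestronglyMeasurable

theorem aestronglyMeasurable_feature_mul (h : IsMixture ν M k φ) (hf : AEMeasurable f ν)
    (hg : AEMeasurable g ν) :
    AEStronglyMeasurable (fun q : (X × X) × Θ => (φ q.2 q.1.1 * f q.1.1) * (φ q.2 q.1.2 * g q.1.2))
      ((ν.prod ν).prod M) := by
  have h1 : Measurable fun q : (X × X) × Θ => φ q.2 q.1.1 :=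
    h.measurable_feature.comp (measurable_snd.prodMk measurable_fst.fst)
  have h2 : Measurable fun q : (X × X) × Θ => φ q.2 q.1.2 :=
    h.measurable_feature.comp (measurable_snd.prodMk measurable_fst.snd)
  exact ((h1.aemeasurable.mul hf.comp_fst.comp_fst).mul
    (h2.aemeasurable.mul hg.comp_snd.comp_fst)).aestronglyMeasurable

theorem measurable_feature_apply (h : IsMixture ν M k φ) (θ : Θ) : Measurable (φ θ) :=
  h.measurable_feature.comp measurable_prodMk_left

theorem measurable_feature_mul_feature (h : IsMixture ν M k φ) (x y : X) :
    Measurable fun θ => φ θ x * φ θ y :=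
  (h.measurable_feature.comp measurable_prodMk_right).mul
    (h.measurable_feature.comp measurable_prodMk_right)

/-- Since the features are nonnegative, absolute values fall only on `f` and `g`, so no cancellation
in `θ` is lost and Tonelli applies. -/
theorem lintegral_enorm_feature_mul (h : IsMixture ν M k φ) :
    ∀ᵐ p ∂(ν.prod ν), ∫⁻ θ, ‖(φ θ p.1 * f p.1) * (φ θ p.2 * g p.2)‖ₑ ∂M
      = ‖k p * f p.1 * g p.2‖ₑ := by
  filter_upwards [h.lintegral_eq] with p hp
  have heq : ∀ θ, ‖(φ θ p.1 * f p.1) * (φ θ p.2 * g p.2)‖ₑ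
      = ENNReal.ofReal (φ θ p.1 * φ θ p.2) * ‖f p.1 * g p.2‖ₑ := fun θ => by
    rw [← Real.enorm_of_nonneg (mul_nonneg (h.feature_nonneg θ _) (h.feature_nonneg θ _)),
      ← enorm_mul]
    congr 1
    ring
  simp only [heq]
  rw [lintegral_mul_const _ (h.measurable_feature_mul_feature _ _).ennreal_ofReal, hp,
    ← Real.enorm_of_nonneg (h.kernel_nonneg p), ← enorm_mul, mul_assoc]

variable [SFinite M]

theorem integrable_feature_mul (h : IsMixture ν M k φ) (hf : AEMeasurable f ν)
    (hg : AEMeasurable g ν) (hfg : Integrable (fun p => k p * f p.1 * g p.2) (ν.prod ν)) :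
    Integrable (fun q : (X × X) × Θ => (φ q.2 q.1.1 * f q.1.1) * (φ q.2 q.1.2 * g q.1.2))
      ((ν.prod ν).prod M) := by
  refine ⟨h.aestronglyMeasurable_feature_mul hf hg, ?_⟩
  rw [HasFiniteIntegral, lintegral_prod _ (h.aestronglyMeasurable_feature_mul hf hg).enorm,
    lintegral_congr_ae h.lintegral_enorm_feature_mul]
  exact hfg.2

variable [SFinite ν]

theorem lintegral_enorm_kernel_mul (h : IsMixture ν M k φ) (hf : AEMeasurable f ν)
    (hg : AEMeasurable g ν) :
    ∫⁻ p, ‖k p * f p.1 * g p.2‖ₑ ∂(ν.prod ν)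
      = ∫⁻ θ, (∫⁻ x, ‖φ θ x * f x‖ₑ ∂ν) * (∫⁻ x, ‖φ θ x * g x‖ₑ ∂ν) ∂M := by
  rw [← lintegral_congr_ae h.lintegral_enorm_feature_mul, lintegral_lintegral_swap]
  · refine lintegral_congr fun θ => ?_
    simp only [enorm_mul (φ _ _ * f _)]
    exact lintegral_prod_mul ((h.measurable_feature_apply θ).aemeasurable.mul hf).enorm
      ((h.measurable_feature_apply θ).aemeasurable.mul hg).enorm
  · exact (h.aestronglyMeasurable_feature_mul hf hg).enorm

/-- Functions of finite energy have finite mutual energy. -/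
theorem integrable_kernel_mul (h : IsMixture ν M k φ) (hf : AEMeasurable f ν)
    (hg : AEMeasurable g ν) (hff : Integrable (fun p => k p * f p.1 * f p.2) (ν.prod ν))
    (hgg : Integrable (fun p => k p * g p.1 * g p.2) (ν.prod ν)) :
    Integrable (fun p => k p * f p.1 * g p.2) (ν.prod ν) := by
  refine ⟨h.aestronglyMeasurable_kernel_mul hf hg, ?_⟩
  have h1 := hff.2
  have h2 := hgg.2
  rw [HasFiniteIntegral, h.lintegral_enorm_kernel_mul] at h1 h2 ⊢ <;> try assumption
  have hm : AEMeasurable (fun θ => (∫⁻ x, ‖φ θ x * f x‖ₑ ∂ν) * (∫⁻ x, ‖φ θ x * f x‖ₑ ∂ν)) M := by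
    have : AEMeasurable (fun θ => ∫⁻ x, ‖φ θ x * f x‖ₑ ∂ν) M :=
      AEMeasurable.lintegral_prod_right' (f := fun q : Θ × X => ‖φ q.1 q.2 * f q.2‖ₑ)
        (h.measurable_feature.aemeasurable.mul hf.comp_snd).enorm
    exact this.mul this
  refine lt_of_le_of_lt (lintegral_mono fun θ => ?_) ((lintegral_add_left' hm _).trans_lt
    (ENNReal.add_lt_top.2 ⟨h1, h2⟩))
  -- A product is at most the square of its larger factor, hence at most the sum of the two squares.
  rcases le_total (∫⁻ x, ‖φ θ x * f x‖ₑ ∂ν) (∫⁻ x, ‖φ θ x * g x‖ₑ ∂ν) with hle | hle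
  · exact (mul_le_mul_left hle _).trans le_add_self
  · exact (mul_le_mul_right hle _).trans le_self_add

theorem integrable_integral_feature_mul (h : IsMixture ν M k φ) (hf : AEMeasurable f ν)
    (hg : AEMeasurable g ν) (hfg : Integrable (fun p => k p * f p.1 * g p.2) (ν.prod ν)) :
    Integrable (fun θ => (∫ x, φ θ x * f x ∂ν) * (∫ x, φ θ x * g x ∂ν)) M := by
  have := (h.integrable_feature_mul hf hg hfg).integral_prod_right
  refine this.congr (.of_forall fun θ => ?_)
  exact integral_prod_mul (fun x => φ θ x * f x) (fun x => φ θ x * g x)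

/-- The energy is an inner product of features. -/
theorem integral_kernel_mul (h : IsMixture ν M k φ) (hf : AEMeasurable f ν)
    (hg : AEMeasurable g ν) (hfg : Integrable (fun p => k p * f p.1 * g p.2) (ν.prod ν)) :
    ∫ p, k p * f p.1 * g p.2 ∂(ν.prod ν)
      = ∫ θ, (∫ x, φ θ x * f x ∂ν) * (∫ x, φ θ x * g x ∂ν) ∂M := by
  have hint := h.integrable_feature_mul hf hg hfg
  calc ∫ p, k p * f p.1 * g p.2 ∂(ν.prod ν)
      = ∫ p, ∫ θ, (φ θ p.1 * f p.1) * (φ θ p.2 * g p.2) ∂M ∂(ν.prod ν) := by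
        refine integral_congr_ae ?_
        filter_upwards [h.lintegral_eq] with p hp
        have heq : ∀ θ, (φ θ p.1 * f p.1) * (φ θ p.2 * g p.2)
            = (φ θ p.1 * φ θ p.2) * (f p.1 * g p.2) := fun θ => by ring
        simp only [heq]
        rw [integral_mul_const, integral_eq_lintegral_of_nonneg_ae
          (.of_forall fun θ => mul_nonneg (h.feature_nonneg θ _) (h.feature_nonneg θ _))
          (h.measurable_feature_mul_feature _ _).aestronglyMeasurable, hp,
          ENNReal.toReal_ofReal (h.kernel_nonneg p), mul_assoc]
    _ = ∫ θ, ∫ p, (φ θ p.1 * f p.1) * (φ θ p.2 * g p.2) ∂(ν.prod ν) ∂M :=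
        integral_integral_swap hint
    _ = ∫ θ, (∫ x, φ θ x * f x ∂ν) * (∫ x, φ θ x * g x ∂ν) ∂M :=
        integral_congr_ae (.of_forall fun θ =>
          integral_prod_mul (fun x => φ θ x * f x) (fun x => φ θ x * g x))

/-- For a function of finite energy, almost every feature converges absolutely. -/
theorem ae_integrable_feature_mul (h : IsMixture ν M k φ) (hf : AEMeasurable f ν)
    (hff : Integrable (fun p => k p * f p.1 * f p.2) (ν.prod ν)) :
    ∀ᵐ θ ∂M, Integrable (fun x => φ θ x * f x) ν := by
  have h1 := hff.2
  rw [HasFiniteIntegral, h.lintegral_enorm_kernel_mul hf hf] at h1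
  have hm : AEMeasurable (fun θ => ∫⁻ x, ‖φ θ x * f x‖ₑ ∂ν) M :=
    AEMeasurable.lintegral_prod_right' (f := fun q : Θ × X => ‖φ q.1 q.2 * f q.2‖ₑ)
      (h.measurable_feature.aemeasurable.mul hf.comp_snd).enorm
  filter_upwards [ae_lt_top' (hm.mul hm) h1.ne] with θ hθ
  refine ⟨((h.measurable_feature_apply θ).aemeasurable.mul hf).aestronglyMeasurable, ?_⟩
  rw [HasFiniteIntegral, lt_top_iff_ne_top]
  intro htop
  rw [Pi.mul_apply, htop, ENNReal.top_mul_top] at hθ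
  exact lt_irrefl _ hθ

/-- Cauchy-Schwarz inequality for the energy. -/
theorem sq_integral_kernel_mul_le (h : IsMixture ν M k φ) (hf : AEMeasurable f ν)
    (hg : AEMeasurable g ν) (hff : Integrable (fun p => k p * f p.1 * f p.2) (ν.prod ν))
    (hgg : Integrable (fun p => k p * g p.1 * g p.2) (ν.prod ν)) :
    (∫ p, k p * f p.1 * g p.2 ∂(ν.prod ν)) ^ 2
      ≤ (∫ p, k p * f p.1 * f p.2 ∂(ν.prod ν)) * ∫ p, k p * g p.1 * g p.2 ∂(ν.prod ν) := by
  have hfg := h.integrable_kernel_mul hf hg hff hgg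
  rw [h.integral_kernel_mul hf hg hfg, h.integral_kernel_mul hf hf hff,
    h.integral_kernel_mul hg hg hgg]
  have Iff := h.integrable_integral_feature_mul hf hf hff
  have Ifg := h.integrable_integral_feature_mul hf hg hfg
  have Igg := h.integrable_integral_feature_mul hg hg hgg
  set A := fun θ => ∫ x, φ θ x * f x ∂ν
  set B := fun θ => ∫ x, φ θ x * g x ∂ν
  -- The quadratic `t ↦ ∫ (t B + A)²` is nonnegative, so its discriminant is nonpositive.
  have hpoly : ∀ t : ℝ, 0 ≤ (∫ θ, B θ * B θ ∂M) * (t * t) + (2 * ∫ θ, A θ * B θ ∂M) * t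
      + ∫ θ, A θ * A θ ∂M := by
    intro t
    have h0 : 0 ≤ ∫ θ, (t * B θ + A θ) ^ 2 ∂M := integral_nonneg fun θ => sq_nonneg _
    have heq : (fun θ => (t * B θ + A θ) ^ 2)
        = fun θ => t * t * (B θ * B θ) + 2 * t * (A θ * B θ) + A θ * A θ := by
      funext θ
      ring
    rw [heq, integral_add (by exact (Igg.const_mul _).add (Ifg.const_mul _)) Iff,
      integral_add (Igg.const_mul _) (Ifg.const_mul _), integral_const_mul,
      integral_const_mul] at h0
    linarith
  have := discrim_le_zero hpoly
  rw [discrim] at this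
  linarith

end IsMixture

/-! ### The Bopp-Podolsky kernel is a mixture -/

theorem measurable_kernel (a : ℝ) : Measurable fun p : R3 × R3 => kernel a (p.1 - p.2) := by
  unfold kernel
  fun_prop

theorem kernel_nonneg {a : ℝ} (ha : 0 < a) (x : R3) : 0 ≤ kernel a x := by
  have : Real.exp (-‖x‖ / a) ≤ 1 :=
    Real.exp_le_one_iff.2 (div_nonpos_of_nonpos_of_nonneg (neg_nonpos.2 (norm_nonneg x)) ha.le)
  exact div_nonneg (by linarith) (norm_nonneg x)

/-- By the parallelogram law about the midpoint `m`, `2 ‖x - z‖² + 2 ‖y - z‖² = ‖x - y‖² + 4 ‖z -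
m‖²`, so the dependence on `z` is a single Gaussian centred at `m`. -/
theorem integral_gaussian_mul_gaussian {u : ℝ} (hu : 0 < u) (x y : R3) :
    Integrable (fun z : R3 => Real.exp (-(2 * u ^ 2 * ‖x - z‖ ^ 2)) *
      Real.exp (-(2 * u ^ 2 * ‖y - z‖ ^ 2))) ∧
    ∫ z : R3, Real.exp (-(2 * u ^ 2 * ‖x - z‖ ^ 2)) * Real.exp (-(2 * u ^ 2 * ‖y - z‖ ^ 2))
      = Real.exp (-(‖x - y‖ ^ 2 * u ^ 2)) * (Real.pi / (4 * u ^ 2)) ^ (3 / 2 : ℝ) := by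
  set m : R3 := (1 / 2 : ℝ) • (x + y) with hm
  have hb : (0 : ℝ) < 4 * u ^ 2 := by positivity
  have heq : (fun z : R3 => Real.exp (-(2 * u ^ 2 * ‖x - z‖ ^ 2)) *
      Real.exp (-(2 * u ^ 2 * ‖y - z‖ ^ 2))) = fun z =>
      Real.exp (-(‖x - y‖ ^ 2 * u ^ 2)) * Real.exp (-(4 * u ^ 2) * ‖z - m‖ ^ 2) := by
    funext z
    rw [← Real.exp_add, ← Real.exp_add]
    have h1 := parallelogram_law_with_norm ℝ (x - z) (y - z)
    have h2 : x - z + (y - z) = (-2 : ℝ) • (z - m) := by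
      rw [hm]
      module
    rw [h2, norm_smul, sub_sub_sub_cancel_right] at h1
    norm_num at h1
    congr 1
    linear_combination u ^ 2 * h1
  have hint : Integrable (fun z : R3 => Real.exp (-(4 * u ^ 2) * ‖z‖ ^ 2)) := by
    -- A non-integrable function has integral `0` by convention, but the Gaussian formula gives a
    -- positive value.
    by_contra hcon
    have h1 := GaussianFourier.integral_rexp_neg_mul_sq_norm (V := R3) hb
    rw [integral_undef hcon] at h1
    exact (Real.rpow_pos_of_pos (div_pos Real.pi_pos hb) _).ne h1
  rw [heq]
  refine ⟨(hint.comp_sub_right m).const_mul _, ?_⟩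
  rw [integral_const_mul, integral_sub_right_eq_self (fun z : R3 => Real.exp (-(4 * u ^ 2) * ‖z‖ ^ 2)) m,
    GaussianFourier.integral_rexp_neg_mul_sq_norm hb]
  simp

/-- The Gaussian factors of the Bopp-Podolsky potential, indexed by width and centre. -/
noncomputable def feature (a : ℝ) (θ : ℝ × R3) (x : R3) : ℝ :=
  √(gaussWeight a θ.1 / (Real.pi / (4 * θ.1 ^ 2)) ^ (3 / 2 : ℝ)) *
    Real.exp (-(2 * θ.1 ^ 2 * ‖x - θ.2‖ ^ 2))

/-- The divisor in `feature` cancels the mass `(π / (4 u²)) ^ (3 / 2)` of the Gaussian in `z`, which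
leaves the weighted Gaussian in `x - y` to integrate over `u`. -/
theorem lintegral_feature_mul_feature {a : ℝ} (ha : 0 < a) {x y : R3} (hxy : x ≠ y) :
    ∫⁻ θ, ENNReal.ofReal (feature a θ x * feature a θ y)
        ∂((volume.restrict (Set.Ioi (0 : ℝ))).prod (volume : Measure R3))
      = ENNReal.ofReal (kernel a (x - y)) := by
  have hmeas : Measurable fun θ : ℝ × R3 => feature a θ x * feature a θ y := by
    unfold feature
    fun_prop
  rw [lintegral_prod _ hmeas.ennreal_ofReal.aemeasurable]
  have hr : 0 < ‖x - y‖ := norm_pos_iff.2 (sub_ne_zero.2 hxy)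
  obtain ⟨hint, hval⟩ := integrableOn_and_integral_gaussWeight ha hr
  rw [kernel, ← hval, ofReal_integral_eq_lintegral_ofReal hint]
  · refine setLIntegral_congr_fun measurableSet_Ioi fun u (hu : 0 < u) => ?_
    have hC : (0 : ℝ) < (Real.pi / (4 * u ^ 2)) ^ (3 / 2 : ℝ) :=
      Real.rpow_pos_of_pos (div_pos Real.pi_pos (by positivity)) _
    have hw := gaussWeight_pos ha hu
    obtain ⟨hint2, hval2⟩ := integral_gaussian_mul_gaussian hu x y
    have heq : (fun z : R3 => feature a (u, z) x * feature a (u, z) y) = fun z =>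
        gaussWeight a u / (Real.pi / (4 * u ^ 2)) ^ (3 / 2 : ℝ) *
          (Real.exp (-(2 * u ^ 2 * ‖x - z‖ ^ 2)) * Real.exp (-(2 * u ^ 2 * ‖y - z‖ ^ 2))) := by
      funext z
      simp only [feature]
      rw [mul_mul_mul_comm, Real.mul_self_sqrt (div_pos hw hC).le]
    have hint3 : Integrable (fun z : R3 => feature a (u, z) x * feature a (u, z) y) := by
      rw [heq]
      exact hint2.const_mul _
    beta_reduce
    rw [← ofReal_integral_eq_lintegral_ofReal hint3
      (.of_forall fun z => by simp only [feature, Pi.zero_apply]; positivity), heq,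
      integral_const_mul, hval2]
    congr 1
    field_simp
  · filter_upwards [ae_restrict_mem measurableSet_Ioi] with u hu
    exact mul_nonneg (gaussWeight_pos ha hu).le (Real.exp_nonneg _)

theorem isMixture_kernel {a : ℝ} (ha : 0 < a) :
    IsMixture (volume : Measure R3) ((volume.restrict (Set.Ioi (0 : ℝ))).prod (volume : Measure R3))
      (fun p : R3 × R3 => kernel a (p.1 - p.2)) (feature a) where
  measurable_kernel := measurable_kernel a
  kernel_nonneg p := kernel_nonneg ha _
  measurable_feature := by
    unfold feature Function.uncurry
    fun_prop
  feature_nonneg θ x := mul_nonneg (Real.sqrt_nonneg _) (Real.exp_nonneg _)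
  lintegral_eq := by
    have hset : MeasurableSet {p : R3 × R3 | p.1 ≠ p.2} :=
      (measurableSet_eq_fun measurable_fst measurable_snd).compl
    -- The mixture formula is only claimed off the diagonal, which is a null set.
    have hne : ∀ᵐ p ∂(volume : Measure R3).prod (volume : Measure R3), p.1 ≠ p.2 := by
      refine (Measure.ae_prod_iff_ae_ae hset).2 (.of_forall fun x => ?_)
      filter_upwards [Measure.ae_ne volume x] with y hy using hy.symm
    filter_upwards [hne] with p hp using lintegral_feature_mul_feature ha hp

/-! ### Finite energy, symmetry and definiteness -/

theorem mem_E1_iff {a : ℝ} (ha : 0 < a) {f : R3 → ℝ} :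
    f ∈ E1 a ↔ AEMeasurable f volume ∧
      Integrable (fun p : R3 × R3 => kernel a (p.1 - p.2) * f p.1 * f p.2)
        (volume.prod volume) := by
  refine and_congr_right fun hf => ?_
  have hm := (isMixture_kernel ha).aestronglyMeasurable_kernel_mul hf hf
  have heq : lenergy a (fun x => |f x|) (fun x => |f x|)
      = ∫⁻ p : R3 × R3, ‖kernel a (p.1 - p.2) * f p.1 * f p.2‖ₑ ∂(volume.prod volume) := by
    rw [lintegral_prod_symm _ hm.enorm]
    refine lintegral_congr fun y => lintegral_congr fun x => ?_
    rw [← Real.enorm_abs, abs_mul, abs_mul, abs_of_nonneg (kernel_nonneg ha _),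
      Real.enorm_of_nonneg (mul_nonneg (mul_nonneg (kernel_nonneg ha _) (abs_nonneg _))
        (abs_nonneg _))]
  rw [heq]
  exact ⟨fun h => ⟨hm, h⟩, fun h => h.2⟩

theorem integrable_kernel_mul {a : ℝ} (ha : 0 < a) {f g : R3 → ℝ} (hf : f ∈ E1 a)
    (hg : g ∈ E1 a) :
    Integrable (fun p : R3 × R3 => kernel a (p.1 - p.2) * f p.1 * g p.2) (volume.prod volume) :=
  (isMixture_kernel ha).integrable_kernel_mul hf.1 hg.1 ((mem_E1_iff ha).1 hf).2
    ((mem_E1_iff ha).1 hg).2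

theorem energy_eq_integral_prod {a : ℝ} (ha : 0 < a) {f g : R3 → ℝ} (hf : f ∈ E1 a)
    (hg : g ∈ E1 a) :
    energy a f g = ∫ p : R3 × R3, kernel a (p.1 - p.2) * f p.1 * g p.2 ∂(volume.prod volume) :=
  (integral_prod_symm _ (integrable_kernel_mul ha hf hg)).symm

theorem energy_eq_integral_feature {a : ℝ} (ha : 0 < a) {f g : R3 → ℝ} (hf : f ∈ E1 a)
    (hg : g ∈ E1 a) :
    energy a f g = ∫ θ, (∫ x, feature a θ x * f x) * (∫ x, feature a θ x * g x)
      ∂((volume.restrict (Set.Ioi (0 : ℝ))).prod (volume : Measure R3)) := by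
  rw [energy_eq_integral_prod ha hf hg]
  exact (isMixture_kernel ha).integral_kernel_mul hf.1 hg.1 (integrable_kernel_mul ha hf hg)

theorem energy_self_nonneg {a : ℝ} (ha : 0 < a) {f : R3 → ℝ} (hf : f ∈ E1 a) :
    0 ≤ energy a f f := by
  rw [energy_eq_integral_feature ha hf hf]
  exact integral_nonneg fun θ => mul_self_nonneg _

theorem energy_comm {a : ℝ} (ha : 0 < a) {f g : R3 → ℝ} (hf : f ∈ E1 a) (hg : g ∈ E1 a) :
    energy a f g = energy a g f := by
  rw [energy_eq_integral_feature ha hf hg, energy_eq_integral_feature ha hg hf]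
  simp only [mul_comm]

/-- The energy is definite. -/
theorem ae_eq_zero_of_energy_self_eq_zero {a : ℝ} (ha : 0 < a) {f : R3 → ℝ} (hf : f ∈ E1 a)
    (h : energy a f f = 0) : f =ᵐ[volume] 0 := by
  have hmix := isMixture_kernel ha
  have hff := ((mem_E1_iff ha).1 hf).2
  rw [energy_eq_integral_feature ha hf hf, integral_eq_zero_iff_of_nonneg
    (fun θ => mul_self_nonneg _) (hmix.integrable_integral_feature_mul hf.1 hf.1 hff)] at h
  have hae : ∀ᵐ u ∂(volume.restrict (Set.Ioi (0 : ℝ))), 0 < u ∧ ∀ᵐ z : R3,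
      Integrable (fun x => f x * Real.exp (-(2 * u ^ 2 * ‖x - z‖ ^ 2))) ∧
      ∫ x, f x * Real.exp (-(2 * u ^ 2 * ‖x - z‖ ^ 2)) = 0 := by
    filter_upwards [ae_restrict_mem measurableSet_Ioi, Measure.ae_ae_of_ae_prod h,
      Measure.ae_ae_of_ae_prod (hmix.ae_integrable_feature_mul hf.1 hff)] with u (hu : 0 < u) h1 h2
    refine ⟨hu, ?_⟩
    filter_upwards [h1, h2] with z h3 h4
    have hne : √(gaussWeight a u / (Real.pi / (4 * u ^ 2)) ^ (3 / 2 : ℝ)) ≠ 0 :=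
      (Real.sqrt_pos.2 (div_pos (gaussWeight_pos ha hu)
        (Real.rpow_pos_of_pos (div_pos Real.pi_pos (by positivity)) _))).ne'
    have heq : (fun x => feature a (u, z) x * f x) = fun x =>
        √(gaussWeight a u / (Real.pi / (4 * u ^ 2)) ^ (3 / 2 : ℝ)) *
          (f x * Real.exp (-(2 * u ^ 2 * ‖x - z‖ ^ 2))) := by
      funext x
      simp only [feature]
      ring
    have h5 := mul_self_eq_zero.1 h3
    rw [heq] at h4 h5
    rw [integral_const_mul] at h5
    exact ⟨(integrable_const_mul_iff hne.isUnit _).1 h4, (mul_eq_zero.1 h5).resolve_left hne⟩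
  -- Every half-line has positive measure, so good widths exist beyond any bound.
  have hIoo : ∀ c : ℝ, 0 ≤ c → ∃ u : ℝ, c < u ∧ ∀ᵐ z : R3,
      Integrable (fun x => f x * Real.exp (-(2 * u ^ 2 * ‖x - z‖ ^ 2))) ∧
      ∫ x, f x * Real.exp (-(2 * u ^ 2 * ‖x - z‖ ^ 2)) = 0 := by
    intro c hc
    have h1 := ae_restrict_of_ae_restrict_of_subset (Set.Ioi_subset_Ioi hc) hae
    have : (ae (volume.restrict (Set.Ioi c))).NeBot := by
      rw [ae_neBot, Ne, Measure.restrict_eq_zero]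
      simp
    obtain ⟨u, h2, h3⟩ := (h1.and (ae_restrict_mem measurableSet_Ioi)).exists
    exact ⟨u, h3, h2.2⟩
  obtain ⟨u₀, hu₀, h0⟩ := hIoo 0 le_rfl
  obtain ⟨z₀, hz₀, -⟩ := h0.exists
  -- With `u > 2 u₀`, the Gaussian of exponent `u²` at `z₀` is dominated by the integrable one of
  -- exponent `2 u₀²`. Doubling `u²` then gives exactly the exponent `2 u²` of the features of width
  -- `u`.
  obtain ⟨u, hu, hz⟩ := hIoo (2 * u₀) (by positivity)
  have hle : 2 * u₀ ^ 2 ≤ u ^ 2 := by nlinarith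
  have hint : Integrable (fun x => f x * Real.exp (-(u ^ 2 * ‖x - z₀‖ ^ 2))) := by
    refine hz₀.norm.mono' (hf.1.aestronglyMeasurable.mul
      (Continuous.aestronglyMeasurable (by fun_prop))) (.of_forall fun x => ?_)
    rw [norm_mul, norm_mul, Real.norm_eq_abs (Real.exp _), Real.norm_eq_abs (Real.exp _),
      Real.abs_exp, Real.abs_exp]
    gcongr
  obtain ⟨hall, hcont⟩ := integrable_mul_gaussian_of_integrable (sq_nonneg u) hint
    hf.1.aestronglyMeasurable
  -- Lebesgue measure charges every nonempty open set, so a continuous function vanishing almost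
  -- everywhere vanishes everywhere.
  have hzero := (Continuous.ae_eq_iff_eq volume hcont continuous_const).1 (hz.mono fun z h => h.2)
  have hu0 : 2 * u ^ 2 ≠ 0 := by nlinarith
  exact ae_eq_zero_of_integral_mul_gaussian_eq_zero hu0 hall (congrFun hzero)

/-! ### The inner product space of almost everywhere classes -/

theorem add_mem_E1 {a : ℝ} (ha : 0 < a) {f g : R3 → ℝ} (hf : f ∈ E1 a) (hg : g ∈ E1 a) :
    f + g ∈ E1 a := by
  refine (mem_E1_iff ha).2 ⟨hf.1.add hg.1, ?_⟩
  refine (((integrable_kernel_mul ha hf hf).add (integrable_kernel_mul ha hf hg)).add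
    ((integrable_kernel_mul ha hg hf).add (integrable_kernel_mul ha hg hg))).congr
    (.of_forall fun p => ?_)
  simp only [Pi.add_apply]
  ring

theorem smul_mem_E1 {a : ℝ} (ha : 0 < a) (c : ℝ) {f : R3 → ℝ} (hf : f ∈ E1 a) :
    c • f ∈ E1 a := by
  refine (mem_E1_iff ha).2 ⟨hf.1.const_smul c, ?_⟩
  refine ((integrable_kernel_mul ha hf hf).const_mul (c * c)).congr (.of_forall fun p => ?_)
  simp only [Pi.smul_apply, smul_eq_mul]
  ring

theorem energy_add_left {a : ℝ} (ha : 0 < a) {f g h : R3 → ℝ} (hf : f ∈ E1 a) (hg : g ∈ E1 a)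
    (hh : h ∈ E1 a) : energy a (f + g) h = energy a f h + energy a g h := by
  rw [energy_eq_integral_prod ha (add_mem_E1 ha hf hg) hh, energy_eq_integral_prod ha hf hh,
    energy_eq_integral_prod ha hg hh,
    ← integral_add (integrable_kernel_mul ha hf hh) (integrable_kernel_mul ha hg hh)]
  simp only [Pi.add_apply, mul_add, add_mul]

theorem energy_smul_left (a c : ℝ) (f g : R3 → ℝ) :
    energy a (c • f) g = c * energy a f g := by
  simp only [energy, ← integral_const_mul, Pi.smul_apply, smul_eq_mul]
  refine integral_congr_ae (.of_forall fun y => integral_congr_ae (.of_forall fun x => ?_))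
  beta_reduce
  ring

theorem energy_congr_ae (a : ℝ) {f f' g g' : R3 → ℝ} (hf : f =ᵐ[volume] f')
    (hg : g =ᵐ[volume] g') : energy a f g = energy a f' g' := by
  refine integral_congr_ae ?_
  filter_upwards [hg] with y hy
  refine integral_congr_ae ?_
  filter_upwards [hf] with x hx
  rw [hx, hy]

theorem mem_E1_congr_ae {a : ℝ} {f f' : R3 → ℝ} (h : f =ᵐ[volume] f') (hf : f ∈ E1 a) :
    f' ∈ E1 a := by
  refine ⟨hf.1.congr h, lt_of_eq_of_lt ?_ hf.2⟩
  refine lintegral_congr_ae ?_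
  filter_upwards [h] with y hy
  refine lintegral_congr_ae ?_
  filter_upwards [h] with x hx
  rw [hx, hy]

/-- The space of functions of finite energy modulo almost everywhere equality. -/
noncomputable def energySpace {a : ℝ} (ha : 0 < a) : Submodule ℝ (R3 →ₘ[volume] ℝ) where
  carrier := {u | (u : R3 → ℝ) ∈ E1 a}
  add_mem' {u v} hu hv := mem_E1_congr_ae (AEEqFun.coeFn_add u v).symm (add_mem_E1 ha hu hv)
  zero_mem' := by
    refine mem_E1_congr_ae (f := 0) AEEqFun.coeFn_zero.symm ((mem_E1_iff ha).2 ⟨?_, ?_⟩)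
    · exact aemeasurable_const
    · simp
  smul_mem' c u hu := mem_E1_congr_ae (AEEqFun.coeFn_smul c u).symm (smul_mem_E1 ha c hu)

/-- The energy as an inner product. -/
@[reducible]
noncomputable def energyCore {a : ℝ} (ha : 0 < a) : InnerProductSpace.Core ℝ (energySpace ha) where
  inner u v := energy a (u : R3 →ₘ[volume] ℝ) (v : R3 →ₘ[volume] ℝ)
  conj_inner_symm u v := energy_comm ha v.2 u.2
  re_inner_nonneg u := energy_self_nonneg ha u.2
  add_left u v w := by
    rw [← energy_add_left ha u.2 v.2 w.2]
    exact energy_congr_ae a (AEEqFun.coeFn_add _ _) .rfl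
  smul_left u v c := by
    refine Eq.trans ?_ (energy_smul_left a c _ _)
    exact energy_congr_ae a (AEEqFun.coeFn_smul _ _) .rfl
  definite u hu := by
    have := ae_eq_zero_of_energy_self_eq_zero ha u.2 hu
    exact Subtype.ext (AEEqFun.ext (this.trans AEEqFun.coeFn_zero.symm))

end BoppPodolsky

theorem mainTheorem7 (a : ℝ) (ha : 0 < a) :
    -- strict positivity
    (∀ f : BoppPodolsky.R3 → ℝ, f ∈ BoppPodolsky.E1 a → ¬ (f =ᵐ[volume] 0) →
      0 < BoppPodolsky.energy a f f) ∧
    -- the energy of a pair is an absolutely convergent integral, with Cauchy-Schwarz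
    (∀ f g : BoppPodolsky.R3 → ℝ, f ∈ BoppPodolsky.E1 a → g ∈ BoppPodolsky.E1 a →
      Integrable (fun p : BoppPodolsky.R3 × BoppPodolsky.R3 =>
        BoppPodolsky.kernel a (p.1 - p.2) * f p.1 * g p.2) (volume.prod volume) ∧
      |BoppPodolsky.energy a f g| ^ 2
        ≤ BoppPodolsky.energy a f f * BoppPodolsky.energy a g g) ∧
    -- modulo a.e. equality, `E1` is a real vector space on which the energy is an inner product
    (∃ E : Submodule ℝ (BoppPodolsky.R3 →ₘ[volume] ℝ),
      (∀ u : BoppPodolsky.R3 →ₘ[volume] ℝ,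
        u ∈ E ↔ (u : BoppPodolsky.R3 → ℝ) ∈ BoppPodolsky.E1 a) ∧
      ∃ c : InnerProductSpace.Core ℝ E, ∀ u v : E,
        c.inner u v = BoppPodolsky.energy a
          ((u : BoppPodolsky.R3 →ₘ[volume] ℝ) : BoppPodolsky.R3 → ℝ)
          ((v : BoppPodolsky.R3 →ₘ[volume] ℝ) : BoppPodolsky.R3 → ℝ)) := by

  refine ⟨fun f hf hne => ?_, fun f g hf hg => ⟨BoppPodolsky.integrable_kernel_mul ha hf hg, ?_⟩,
    BoppPodolsky.energySpace ha, fun u => Iff.rfl, BoppPodolsky.energyCore ha, fun u v => rfl⟩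
  · exact (BoppPodolsky.energy_self_nonneg ha hf).lt_of_ne fun h =>
      hne (BoppPodolsky.ae_eq_zero_of_energy_self_eq_zero ha hf h.symm)
  · rw [sq_abs, BoppPodolsky.energy_eq_integral_prod ha hf hg,
      BoppPodolsky.energy_eq_integral_prod ha hf hf, BoppPodolsky.energy_eq_integral_prod ha hg hg]
    exact (BoppPodolsky.isMixture_kernel ha).sq_integral_kernel_mul_le hf.1 hg.1
      ((BoppPodolsky.mem_E1_iff ha).1 hf).2 ((BoppPodolsky.mem_E1_iff ha).1 hg).2
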